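/- For $a\in\mathbb{R}$ and $j\ge 0$ let $k^{-a}(j)$ denote the $j$-th Taylor coefficient at the origin of the function $t\mapsto(1-t)^a$. For a sequence of real numbers $\Lambda=\{\Lambda_n\}_{n\ge0}$ put $$(1-\nabla)^a\Lambda_n:=\sum_{j=0}^{\infty}k^{-a}(j)\,\Lambda_{j+n}=\lim_{N\to\infty}\sum_{j=0}^{N}k^{-a}(j)\,\Lambda_{j+n}\qquad(n\ge0),$$ and say that $(1-\nabla)^a\Lambda$ is well defined if this series converges (not necessarily absolutely) for every $n\ge0$. Theorem. Let $\Lambda=\{\Lambda_n\}_{n\ge0}$ be a sequence of real numbers and let $0<b<a$, where $b$ is not an integer. If $(1-\nabla)^a\Lambda$ is well defined with $(1-\nabla)^a\Lambda_n\ge0$ for every $n\ge0$, and $(1-\nabla)^b\Lambda$ is well defined, then $(1-\nabla)^b\Lambda_n\ge0$ for every $n\ge0$. -/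

import Mathlib

/-- The Cesàro number `k^a(j)`: the `j`-th Taylor coefficient at the origin of `t ↦ (1 - t)^(-a)`. -/
noncomputable def cesaroNumber (a : ℝ) (j : ℕ) : ℝ :=
  iteratedDeriv j (fun t : ℝ => (1 - t) ^ (-a)) 0 / (j.factorial : ℝ)

/-- The `j`-th term `k^{-a}(j) Λ_{j+n}` of the series defining `(1 - ∇)^a Λ_n`. -/
noncomputable def fracDiffTerm (a : ℝ) (Λ : ℕ → ℝ) (n j : ℕ) : ℝ :=
  cesaroNumber (-a) j * Λ (j + n)

/-- `(1 - ∇)^a Λ` is well defined: for every `n` the defining series converges in the ordinary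
(possibly conditional) sense, i.e. its partial sums over `0, …, N` converge as `N → ∞`. -/
def FracDiffWellDefined (a : ℝ) (Λ : ℕ → ℝ) : Prop :=
  ∀ n : ℕ, Summable (fracDiffTerm a Λ n) (SummationFilter.conditional ℕ)

/-- The forward difference `(1 - ∇)^a Λ_n = ∑_{j ≥ 0} k^{-a}(j) Λ_{j+n}` of order `a`, the sum being
the limit of the partial sums. It is meaningful when `FracDiffWellDefined a Λ` holds. -/
noncomputable def fracDiff (a : ℝ) (Λ : ℕ → ℝ) (n : ℕ) : ℝ :=
  ∑'[SummationFilter.conditional ℕ] j, fracDiffTerm a Λ n j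

open Finset Filter Topology

/-! Write `u = (1 - ∇)^a Λ` and `d = a - b > 0`. Formally `(1 - ∇)^b Λ = (1 - ∇)^(-d) u`, a series
with nonnegative terms `k^d(j) u_{j + n}`, but the conditional convergence of the two given series
does not allow this rearrangement. Truncating it with Cesàro weights `w_M` of an order `K ≥ a`
gives finite nonnegative sums, which are the sums of the series for `(1 - ∇)^b Λ_n` with its `m`-th
term multiplied by `φ_M(m) = (∑ j ≤ m, w_M(j) k^d(j) k^{-a}(m - j)) / k^{-b}(m)`. A multiplier
`φ_M(m)` is a mean of `w_M` for a signed Pólya urn distribution, and one draw from the urn expresses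
its increment in `m` through a mean of the same kind for weights of order `K - 1`. By induction on
`K` the increments are `O(1 / M)` for `m < M`; for `m ≥ M`, where `w_M` removes the indices at which
`k^{-a}(m - j)` changes sign, `φ_M` has constant sign and `|φ_M|` decreases. So the multipliers tend
to `1` with uniformly bounded variation, and the finite nonnegative sums tend to `(1 - ∇)^b Λ_n`. -/

section CesaroNumber

lemma cesaroNumber_eq_ascPochhammer_div (a : ℝ) (j : ℕ) :
    cesaroNumber a j = (ascPochhammer ℝ j).eval a / j.factorial := by
  have hderiv : iteratedDeriv j (fun t : ℝ => (1 - t) ^ (-a)) 0 = (ascPochhammer ℝ j).eval a := by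
    simp only [iteratedDeriv_comp_const_sub j (fun t : ℝ => t ^ (-a)) 1,
      iteratedDeriv_eq_iterate, Real.iter_deriv_rpow_const, sub_zero, Real.one_rpow, mul_one,
      smul_eq_mul, ← ascPochhammer_eval_neg_eq_descPochhammer, neg_neg]
  rw [cesaroNumber, hderiv]

@[simp]
lemma cesaroNumber_zero_right (a : ℝ) : cesaroNumber a 0 = 1 := by
  simp [cesaroNumber_eq_ascPochhammer_div]

lemma succ_mul_cesaroNumber_succ (a : ℝ) (j : ℕ) :
    ((j : ℝ) + 1) * cesaroNumber a (j + 1) = (a + j) * cesaroNumber a j := by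
  simp only [cesaroNumber_eq_ascPochhammer_div, ascPochhammer_succ_eval, Nat.factorial_succ,
    Nat.cast_mul, Nat.cast_succ]
  field_simp

lemma mul_cesaroNumber_add_one (a : ℝ) (j : ℕ) :
    a * cesaroNumber (a + 1) j = (a + j) * cesaroNumber a j := by
  have h : a * (ascPochhammer ℝ j).eval (a + 1) = (ascPochhammer ℝ (j + 1)).eval a := by
    simp [ascPochhammer_succ_left]
  rw [cesaroNumber_eq_ascPochhammer_div, cesaroNumber_eq_ascPochhammer_div, ← mul_div_assoc, h,
    ascPochhammer_succ_eval]
  ring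

lemma cesaroNumber_pos {a : ℝ} (ha : 0 < a) (j : ℕ) : 0 < cesaroNumber a j := by
  rw [cesaroNumber_eq_ascPochhammer_div]
  exact div_pos (ascPochhammer_pos j a ha) (by positivity)

lemma cesaroNumber_ne_zero {a : ℝ} (ha : ∀ i : ℕ, a ≠ -i) (j : ℕ) : cesaroNumber a j ≠ 0 := by
  rw [cesaroNumber_eq_ascPochhammer_div]
  refine div_ne_zero (fun h => ?_) (by positivity)
  obtain ⟨i, -, hi⟩ := (ascPochhammer_eval_eq_zero_iff j a).mp h
  exact ha i (by linarith)

lemma exists_sign_cesaroNumber {a : ℝ} {K : ℕ} (hK : 0 ≤ a + K) :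
    ∃ s : ℝ, |s| = 1 ∧ ∀ j, K ≤ j → 0 ≤ s * cesaroNumber a j := by
  obtain ⟨s, hs, hsK⟩ : ∃ s : ℝ, |s| = 1 ∧ 0 ≤ s * cesaroNumber a K := by
    rcases le_total 0 (cesaroNumber a K) with h | h
    · exact ⟨1, by simp, by simpa using h⟩
    · exact ⟨-1, by simp, by simpa using h⟩
  refine ⟨s, hs, fun j hj => ?_⟩
  induction j, hj using Nat.le_induction with
  | base => exact hsK
  | succ j hj ih =>
    have hKj : (K : ℝ) ≤ j := by exact_mod_cast hj
    have hmul :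
        ((j : ℝ) + 1) * (s * cesaroNumber a (j + 1)) = (a + j) * (s * cesaroNumber a j) := by
      linear_combination s * succ_mul_cesaroNumber_succ a j
    refine nonneg_of_mul_nonneg_right ?_ (by positivity : (0 : ℝ) < j + 1)
    exact hmul ▸ mul_nonneg (by linarith) ih

end CesaroNumber

section PolyaMean

/-- The mean of `w` for the signed distribution on `{0, …, m}` whose value at `j` is
`k^d(j) k^e(m - j) / k^{d + e}(m)`. If `d` and `e` are positive, this is the distribution of the
number of draws of the first colour among `m` draws from a Pólya urn that starts with weights `d`
and `e`. -/
noncomputable def polyaMean (d e : ℝ) (w : ℕ → ℝ) (m : ℕ) : ℝ :=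
  (∑ p ∈ antidiagonal m, w p.1 * (cesaroNumber d p.1 * cesaroNumber e p.2)) /
    cesaroNumber (d + e) m

variable {d e : ℝ}

@[simp]
lemma polyaMean_zero_right (d e : ℝ) (w : ℕ → ℝ) : polyaMean d e w 0 = w 0 := by
  simp [polyaMean]

lemma polyaMean_congr {v w : ℕ → ℝ} {m : ℕ} (h : ∀ j ≤ m, v j = w j) :
    polyaMean d e v m = polyaMean d e w m := by
  unfold polyaMean
  congr 1
  exact sum_congr rfl fun p hp => by rw [h p.1 (by have := mem_antidiagonal.mp hp; lia)]

lemma polyaMean_const_mul (d e c : ℝ) (w : ℕ → ℝ) (m : ℕ) :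
    polyaMean d e (fun j => c * w j) m = c * polyaMean d e w m := by
  simp only [polyaMean, mul_assoc, ← mul_sum, mul_div_assoc]

/-- One draw from the urn: the first colour has weight `d + j` and the second `e + (m - j)`. -/
lemma succ_mul_sum_antidiagonal_succ (d e : ℝ) (w : ℕ → ℝ) (m : ℕ) :
    ((m : ℝ) + 1) *
        ∑ p ∈ antidiagonal (m + 1), w p.1 * (cesaroNumber d p.1 * cesaroNumber e p.2) =
      ∑ p ∈ antidiagonal m, ((d + p.1) * w (p.1 + 1) + (e + p.2) * w p.1) *
        (cesaroNumber d p.1 * cesaroNumber e p.2) := by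
  have hsplit : ∀ p ∈ antidiagonal (m + 1),
      ((m : ℝ) + 1) * (w p.1 * (cesaroNumber d p.1 * cesaroNumber e p.2)) =
        w p.1 * (p.1 * cesaroNumber d p.1 * cesaroNumber e p.2) +
          w p.1 * (cesaroNumber d p.1 * (p.2 * cesaroNumber e p.2)) := fun p hp => by
    have hp' : (p.1 : ℝ) + p.2 = m + 1 := by exact_mod_cast mem_antidiagonal.mp hp
    rw [← hp']
    ring
  rw [mul_sum, sum_congr rfl hsplit, sum_add_distrib, Nat.sum_antidiagonal_succ,
    Nat.sum_antidiagonal_succ']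
  simp only [Nat.cast_zero, zero_mul, mul_zero, zero_add, Nat.cast_add, Nat.cast_one,
    succ_mul_cesaroNumber_succ, ← sum_add_distrib]
  exact sum_congr rfl fun p _ => by ring

lemma polyaMean_succ_sub (hde : ∀ i : ℕ, d + e ≠ -i) (w : ℕ → ℝ) (m : ℕ) :
    polyaMean d e w (m + 1) - polyaMean d e w m =
      polyaMean d e (fun j => (d + j) * (w (j + 1) - w j)) m / (d + e + m) := by
  have hc : d + e + m ≠ 0 := fun h => hde m (by linarith)
  have hm : (m : ℝ) + 1 ≠ 0 := by positivity
  have hsucc : polyaMean d e w (m + 1) =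
      (∑ p ∈ antidiagonal m, ((d + p.1) * w (p.1 + 1) + (e + p.2) * w p.1) *
        (cesaroNumber d p.1 * cesaroNumber e p.2)) / ((d + e + m) * cesaroNumber (d + e) m) := by
    rw [← succ_mul_sum_antidiagonal_succ, ← succ_mul_cesaroNumber_succ, mul_div_mul_left _ _ hm,
      polyaMean]
  rw [hsucc, polyaMean, polyaMean, ← mul_div_mul_left _ (cesaroNumber (d + e) m) hc, ← sub_div,
    div_div, mul_comm (d + e + m) (cesaroNumber _ _), mul_sum, ← sum_sub_distrib]
  congr 1
  refine sum_congr rfl fun p hp => ?_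
  have hp' : (p.1 : ℝ) + p.2 = m := by exact_mod_cast mem_antidiagonal.mp hp
  rw [← hp']
  ring

lemma polyaMean_succ_sub_eq_polyaMean_add_one (hde : ∀ i : ℕ, d + e ≠ -i) (w : ℕ → ℝ) (m : ℕ) :
    polyaMean d e w (m + 1) - polyaMean d e w m =
      d / (d + e) * polyaMean (d + 1) e (fun j => w (j + 1) - w j) m := by
  rw [polyaMean_succ_sub hde, polyaMean, polyaMean, div_div, mul_comm (cesaroNumber _ _),
    add_right_comm d 1 e, ← mul_cesaroNumber_add_one, div_mul_div_comm, mul_sum]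
  congr 1
  refine sum_congr rfl fun p _ => ?_
  linear_combination -(w (p.1 + 1) - w p.1) * cesaroNumber e p.2 * mul_cesaroNumber_add_one d p.1

lemma polyaMean_one (hde : ∀ i : ℕ, d + e ≠ -i) (m : ℕ) : polyaMean d e (fun _ => 1) m = 1 := by
  induction m with
  | zero => simp
  | succ m ih =>
    have hdraw : polyaMean d e (fun j => (d + j) * (1 - 1)) m = 0 := by simp [polyaMean]
    rw [← sub_eq_zero]
    nth_rw 2 [← ih]
    rw [polyaMean_succ_sub hde, hdraw, zero_div]

/-- The weights vanish at the indices `j > M - K`, so that `k^e` is evaluated only at indices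
`m - j ≥ K`, where its sign is constant. -/
lemma exists_sign_polyaMean (hd : 0 < d) {K M : ℕ} (he : 0 ≤ e + K) (hKM : K ≤ M) :
    ∃ s : ℝ, |s| = 1 ∧ ∀ w : ℕ → ℝ, (∀ j, 0 ≤ w j) → (∀ j, M < j + K → w j = 0) →
      ∀ m, M ≤ m → 0 ≤ s * polyaMean d e w m := by
  obtain ⟨s, hs, hes⟩ := exists_sign_cesaroNumber he
  obtain ⟨s', hs', hdes⟩ := exists_sign_cesaroNumber (a := d + e) (K := K) (by linarith)
  refine ⟨s * s', by rw [abs_mul, hs, hs', one_mul], fun w hw hw0 m hm => ?_⟩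
  have hss : s' * s' = 1 := by rw [← abs_mul_abs_self, hs', one_mul]
  have hnum : 0 ≤ s * ∑ p ∈ antidiagonal m, w p.1 * (cesaroNumber d p.1 * cesaroNumber e p.2) := by
    rw [mul_sum]
    refine sum_nonneg fun p hp => ?_
    rcases lt_or_ge M (p.1 + K) with hp1 | hp1
    · simp [hw0 p.1 hp1]
    · have hp2 : K ≤ p.2 := by have := mem_antidiagonal.mp hp; lia
      calc 0 ≤ w p.1 * cesaroNumber d p.1 * (s * cesaroNumber e p.2) :=
            mul_nonneg (mul_nonneg (hw _) (cesaroNumber_pos hd _).le) (hes _ hp2)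
        _ = s * (w p.1 * (cesaroNumber d p.1 * cesaroNumber e p.2)) := by ring
  calc 0 ≤ (s * ∑ p ∈ antidiagonal m, w p.1 * (cesaroNumber d p.1 * cesaroNumber e p.2)) /
        (s' * cesaroNumber (d + e) m) := div_nonneg hnum (hdes m (hKM.trans hm))
    _ = s * s' * polyaMean d e w m := by
      rw [mul_div_mul_comm, div_eq_mul_inv s s', inv_eq_of_mul_eq_one_right hss, polyaMean]

lemma exists_sign_antitone_polyaMean (hd : 0 < d) (hde : ∀ i : ℕ, d + e ≠ -i) {K M : ℕ}
    (he : 0 ≤ e + K) (hKM : K ≤ M) {w : ℕ → ℝ} (hw : Antitone w)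
    (hw0 : ∀ j, M < j + K → w j = 0) :
    ∃ s : ℝ, |s| = 1 ∧ ∀ m, M ≤ m → 0 ≤ s * polyaMean d e w m ∧
      s * polyaMean d e w (m + 1) ≤ s * polyaMean d e w m := by
  obtain ⟨s, hs, hsign⟩ := exists_sign_polyaMean hd he hKM
  refine ⟨s, hs, fun m hm => ⟨hsign w (fun j => ?_) hw0 m hm, ?_⟩⟩
  · exact (hw0 (j + M + 1) (by lia)).ge.trans (hw (by lia))
  · have hdecr : 0 ≤ s * polyaMean d e (fun j => (d + j) * (w j - w (j + 1))) m := by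
      refine hsign _ (fun j => ?_) (fun j hj => ?_) m hm
      · exact mul_nonneg (by positivity) (sub_nonneg.mpr (hw j.le_succ))
      · rw [hw0 j hj, hw0 (j + 1) (by lia), sub_self, mul_zero]
    have hneg : polyaMean d e (fun j => (d + j) * (w (j + 1) - w j)) m =
        -polyaMean d e (fun j => (d + j) * (w j - w (j + 1))) m := by
      rw [← neg_one_mul, ← polyaMean_const_mul]
      exact polyaMean_congr fun j _ => by ring
    have hKm : (K : ℝ) ≤ m := by exact_mod_cast hKM.trans hm
    have hsub : s * polyaMean d e w (m + 1) - s * polyaMean d e w m =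
        -(s * polyaMean d e (fun j => (d + j) * (w j - w (j + 1))) m / (d + e + m)) := by
      rw [← mul_sub, polyaMean_succ_sub hde, hneg]
      ring
    exact sub_nonpos.mp (hsub ▸ neg_nonpos.mpr (div_nonneg hdecr (by linarith)))

end PolyaMean

section CesaroWeight

/-- The weight of the `j`-th term of a series in its Cesàro mean of order `K` over the terms of
index at most `M - K`. For `K = 0`, truncated subtraction makes it `1` at every `j`, also beyond
`M`. -/
noncomputable def cesaroWeight (K M j : ℕ) : ℝ :=
  (M - j).choose K / M.choose K

lemma cesaroWeight_zero_right {K M : ℕ} (hKM : K ≤ M) : cesaroWeight K M 0 = 1 :=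
  div_self (by exact_mod_cast (Nat.choose_pos hKM).ne')

lemma cesaroWeight_nonneg (K M j : ℕ) : 0 ≤ cesaroWeight K M j := by
  unfold cesaroWeight
  positivity

lemma antitone_cesaroWeight (K M : ℕ) : Antitone (cesaroWeight K M) := fun i j hij => by
  unfold cesaroWeight
  gcongr

lemma cesaroWeight_eq_zero {K M j : ℕ} (hK : 0 < K) (hj : M < j + K) : cesaroWeight K M j = 0 := by
  rw [cesaroWeight, Nat.choose_eq_zero_of_lt (by lia), Nat.cast_zero, zero_div]

lemma cesaroWeight_succ_sub {K M j : ℕ} (hKM : K ≤ M) (hj : j ≤ M) :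
    cesaroWeight (K + 1) (M + 1) (j + 1) - cesaroWeight (K + 1) (M + 1) j =
      -((K + 1) / (M + 1)) * cesaroWeight K M j := by
  have hpascal : ((M + 1 - j).choose (K + 1) : ℝ) = (M - j).choose K + (M - j).choose (K + 1) := by
    rw [Nat.sub_add_comm hj]
    exact_mod_cast Nat.choose_succ_succ (M - j) K
  have habsorb : ((M : ℝ) + 1) * M.choose K = (M + 1).choose (K + 1) * (K + 1) := by
    exact_mod_cast Nat.add_one_mul_choose_eq M K
  have hne : ((M + 1).choose (K + 1) : ℝ) ≠ 0 := by exact_mod_cast (Nat.choose_pos (by lia)).ne'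
  have hne' : (M.choose K : ℝ) ≠ 0 := by exact_mod_cast (Nat.choose_pos hKM).ne'
  rw [cesaroWeight, cesaroWeight, cesaroWeight, Nat.add_sub_add_right, hpascal]
  field_simp
  linear_combination -((M - j).choose K : ℝ) * habsorb

end CesaroWeight

section BoundedVariation

variable {d e : ℝ}

lemma sum_range_le_of_le_div {f : ℕ → ℝ} {C : ℝ} (hC : 0 ≤ C) {M n : ℕ} (hn : n ≤ M)
    (hf : ∀ m < n, f m ≤ C / M) : ∑ m ∈ range n, f m ≤ C :=
  calc ∑ m ∈ range n, f m ≤ ∑ _m ∈ range n, C / M :=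
        sum_le_sum fun m hm => hf m (mem_range.mp hm)
    _ = C * (n / M) := by rw [sum_const, card_range, nsmul_eq_mul]; ring
    _ ≤ C := mul_le_of_le_one_right hC (div_le_one_of_le₀ (by exact_mod_cast hn) (by positivity))

lemma sum_range_abs_succ_sub_le {f : ℕ → ℝ} {M : ℕ} (hpos : ∀ m, M ≤ m → 0 ≤ f m)
    (hanti : ∀ m, M ≤ m → f (m + 1) ≤ f m) (L : ℕ) :
    ∑ m ∈ range L, |f (m + 1) - f m| ≤ ∑ m ∈ range M, |f (m + 1) - f m| + f M := by
  have htail : ∑ i ∈ range L, |f (M + i + 1) - f (M + i)| = f M - f (M + L) := by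
    refine (sum_congr rfl fun i _ => ?_).trans (sum_range_sub' (fun i => f (M + i)) L)
    rw [abs_of_nonpos (sub_nonpos.mpr (hanti _ (by lia))), neg_sub, add_assoc]
  calc ∑ m ∈ range L, |f (m + 1) - f m|
      ≤ ∑ m ∈ range (M + L), |f (m + 1) - f m| :=
        sum_le_sum_of_subset_of_nonneg (range_subset_range.mpr (by lia)) fun _ _ _ => abs_nonneg _
    _ = ∑ m ∈ range M, |f (m + 1) - f m| + (f M - f (M + L)) := by rw [sum_range_add, htail]
    _ ≤ ∑ m ∈ range M, |f (m + 1) - f m| + f M := by linarith [hpos (M + L) (by lia)]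

lemma abs_polyaMean_cesaroWeight_le {K M m : ℕ} {C : ℝ} (hKM : K ≤ M)
    (hC : ∑ i ∈ range m, |polyaMean d e (cesaroWeight K M) (i + 1) -
      polyaMean d e (cesaroWeight K M) i| ≤ C) :
    |polyaMean d e (cesaroWeight K M) m| ≤ 1 + C := by
  have htele := sum_range_sub (polyaMean d e (cesaroWeight K M)) m
  rw [polyaMean_zero_right, cesaroWeight_zero_right hKM] at htele
  calc |polyaMean d e (cesaroWeight K M) m|
      = |1 + ∑ i ∈ range m, (polyaMean d e (cesaroWeight K M) (i + 1) -
          polyaMean d e (cesaroWeight K M) i)| := by rw [htele, add_sub_cancel]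
    _ ≤ |1| + ∑ i ∈ range m, |polyaMean d e (cesaroWeight K M) (i + 1) -
          polyaMean d e (cesaroWeight K M) i| :=
        (abs_add_le _ _).trans (by gcongr; exact abs_sum_le_sum_abs _ _)
    _ ≤ 1 + C := by rw [abs_one]; gcongr

lemma exists_abs_polyaMean_cesaroWeight_succ_sub_le (K : ℕ) (hde : ∀ i : ℕ, d + e ≠ -i) :
    ∃ C : ℝ, 0 ≤ C ∧ ∀ M m, K ≤ M → m < M →
      |polyaMean d e (cesaroWeight K M) (m + 1) - polyaMean d e (cesaroWeight K M) m| ≤ C / M := by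
  induction K generalizing d with
  | zero =>
    refine ⟨0, le_rfl, fun M m _ _ => ?_⟩
    have hone : cesaroWeight 0 M = fun _ => 1 := by ext; simp [cesaroWeight]
    simp [hone, polyaMean_one hde]
  | succ K ih =>
    obtain ⟨C, hC0, hC⟩ := ih (d := d + 1) fun i hi => hde (i + 1) (by push_cast; linarith)
    refine ⟨|d / (d + e)| * (K + 1) * (1 + C), by positivity, fun M m hKM hm => ?_⟩
    obtain ⟨M, rfl⟩ : ∃ N, M = N + 1 := ⟨M - 1, by lia⟩
    have hbound : |polyaMean (d + 1) e (cesaroWeight K M) m| ≤ 1 + C :=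
      abs_polyaMean_cesaroWeight_le (by lia) (sum_range_le_of_le_div hC0 (by lia)
        fun i hi => hC M i (by lia) (by lia))
    rw [polyaMean_succ_sub_eq_polyaMean_add_one hde,
      polyaMean_congr fun j hj => cesaroWeight_succ_sub (K := K) (M := M) (by lia) (by lia),
      polyaMean_const_mul, abs_mul, abs_mul, abs_neg,
      abs_of_nonneg (show (0 : ℝ) ≤ (K + 1) / (M + 1) by positivity)]
    calc |d / (d + e)| * ((K + 1) / (M + 1) * |polyaMean (d + 1) e (cesaroWeight K M) m|)
        ≤ |d / (d + e)| * ((K + 1) / (M + 1) * (1 + C)) := by gcongr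
      _ = |d / (d + e)| * (K + 1) * (1 + C) / ((M + 1 : ℕ) : ℝ) := by push_cast; ring

lemma exists_sum_abs_polyaMean_cesaroWeight_succ_sub_le (hd : 0 < d) (hde : ∀ i : ℕ, d + e ≠ -i)
    {K : ℕ} (hK : 0 < K) (he : 0 ≤ e + K) :
    ∃ V : ℝ, ∀ M, K ≤ M → ∀ L, ∑ m ∈ range L,
      |polyaMean d e (cesaroWeight K M) (m + 1) - polyaMean d e (cesaroWeight K M) m| ≤ V := by
  obtain ⟨C, hC0, hC⟩ := exists_abs_polyaMean_cesaroWeight_succ_sub_le K hde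
  refine ⟨C + (1 + C), fun M hKM L => ?_⟩
  obtain ⟨s, hs, hanti⟩ := exists_sign_antitone_polyaMean hd hde he hKM
    (antitone_cesaroWeight K M) fun j hj => cesaroWeight_eq_zero hK hj
  have hhead : ∑ m ∈ range M,
      |polyaMean d e (cesaroWeight K M) (m + 1) - polyaMean d e (cesaroWeight K M) m| ≤ C :=
    sum_range_le_of_le_div hC0 le_rfl fun m hm => hC M m hKM hm
  have htail : s * polyaMean d e (cesaroWeight K M) M ≤ 1 + C :=
    calc s * polyaMean d e (cesaroWeight K M) M
        ≤ |s * polyaMean d e (cesaroWeight K M) M| := le_abs_self _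
      _ ≤ 1 + C := by
        rw [abs_mul, hs, one_mul]
        exact abs_polyaMean_cesaroWeight_le hKM hhead
  have habs : ∀ x : ℝ, |s * x| = |x| := fun x => by rw [abs_mul, hs, one_mul]
  have hvar := sum_range_abs_succ_sub_le (fun m hm => (hanti m hm).1) (fun m hm => (hanti m hm).2) L
  simp only [← mul_sub, habs] at hvar
  linarith

end BoundedVariation

section Multipliers

variable {ι 𝕜 E : Type*} [NormedField 𝕜] [SeminormedAddCommGroup E] [NormedSpace 𝕜 E]
  {l : Filter ι} {y : ℕ → E} {V : ℝ}

lemma eventually_norm_sum_smul_le {c : ι → ℕ → 𝕜} (hy : Tendsto y atTop (𝓝 0))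
    (hV : ∀ᶠ M in l, ∀ L, ∑ m ∈ range L, ‖c M m‖ ≤ V) (hc : ∀ m, Tendsto (c · m) l (𝓝 0))
    {ε : ℝ} (hε : 0 < ε) : ∀ᶠ M in l, ∀ L, ‖∑ m ∈ range L, c M m • y m‖ ≤ ε := by
  set δ := ε / (1 + |V|)
  have hδ : 0 < δ := by positivity
  obtain ⟨m₀, hm₀⟩ : ∃ m₀, ∀ m, m₀ ≤ m → ‖y m‖ ≤ δ :=
    eventually_atTop.mp (hy.norm.eventually_le_const (by rwa [norm_zero]))
  have hhead : Tendsto (fun M => ∑ m ∈ range m₀, ‖c M m • y m‖) l (𝓝 0) := by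
    simpa using tendsto_finsetSum (range m₀) fun m _ => ((hc m).smul_const (y m)).norm
  filter_upwards [hV, hhead.eventually_le_const hδ] with M hVM hheadM L
  calc ‖∑ m ∈ range L, c M m • y m‖
      ≤ ∑ m ∈ range L, ‖c M m • y m‖ := norm_sum_le _ _
    _ ≤ ∑ m ∈ range (m₀ + L), ‖c M m • y m‖ :=
        sum_le_sum_of_subset_of_nonneg (range_subset_range.mpr (by lia)) fun _ _ _ => norm_nonneg _
    _ = ∑ m ∈ range m₀, ‖c M m • y m‖ + ∑ i ∈ range L, ‖c M (m₀ + i) • y (m₀ + i)‖ :=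
        sum_range_add _ _ _
    _ ≤ δ + ∑ i ∈ range L, ‖c M (m₀ + i)‖ * δ := by
        gcongr with i
        exact (norm_smul_le _ _).trans (by gcongr; exact hm₀ _ (by lia))
    _ ≤ δ + V * δ := by
        rw [← sum_mul]
        gcongr
        refine le_trans ?_ (hVM (m₀ + L))
        rw [sum_range_add]
        exact le_add_of_nonneg_left (sum_nonneg fun _ _ => norm_nonneg _)
    _ ≤ (1 + |V|) * δ := by rw [one_add_mul]; gcongr; exact le_abs_self V
    _ = ε := mul_div_cancel₀ _ (by positivity)

variable {B : E}

lemma tendsto_sum_succ_sub_smul {φ : ℕ → 𝕜} {x : E}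
    (hy : Tendsto (fun L => ∑ m ∈ range L, y m) atTop (𝓝 B))
    (hV : ∀ L, ∑ m ∈ range L, ‖φ (m + 1) - φ m‖ ≤ V)
    (hx : Tendsto (fun L => ∑ m ∈ range L, φ m • y m) atTop (𝓝 x)) :
    Tendsto (fun L => ∑ m ∈ range L, (φ (m + 1) - φ m) • (∑ i ∈ range (m + 1), y i - B)) atTop
      (𝓝 (φ 0 • B - x)) := by
  have hbdd : ∀ L, ‖φ L‖ ≤ ‖φ 0‖ + V := fun L =>
    calc ‖φ L‖ = ‖φ 0 + ∑ m ∈ range L, (φ (m + 1) - φ m)‖ := by rw [sum_range_sub, add_sub_cancel]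
      _ ≤ ‖φ 0‖ + V := (norm_add_le _ _).trans (by gcongr; exact (norm_sum_le _ _).trans (hV L))
  have hrest : Tendsto (fun L => ∑ i ∈ range (L + 1), y i - B) atTop (𝓝 0) := by
    simpa using (hy.comp (tendsto_add_atTop_nat 1)).sub_const B
  have hend : Tendsto (fun L => φ L • (∑ i ∈ range (L + 1), y i - B)) atTop (𝓝 0) :=
    (isBoundedUnder_of ⟨_, hbdd⟩).smul_tendsto_zero hrest
  have hparts : ∀ L, ∑ m ∈ range L, (φ (m + 1) - φ m) • (∑ i ∈ range (m + 1), y i - B) =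
      φ L • (∑ i ∈ range (L + 1), y i - B) +
        (φ 0 • B - ∑ m ∈ range (L + 1), φ m • y m) := fun L => by
    rw [sum_range_by_parts φ y (L + 1), Nat.add_sub_cancel]
    simp only [smul_sub]
    rw [sum_sub_distrib, ← sum_smul, sum_range_sub, sub_smul]
    abel
  simp only [hparts]
  simpa using hend.add ((hx.comp (tendsto_add_atTop_nat 1)).const_sub (φ 0 • B))

lemma tendsto_of_tendsto_sum_smul {φ : ι → ℕ → 𝕜} {x : ι → E}
    (hy : Tendsto (fun L => ∑ m ∈ range L, y m) atTop (𝓝 B)) (h0 : Tendsto (φ · 0) l (𝓝 1))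
    (hV : ∀ᶠ M in l, ∀ L, ∑ m ∈ range L, ‖φ M (m + 1) - φ M m‖ ≤ V)
    (hφ : ∀ m, Tendsto (fun M => φ M (m + 1) - φ M m) l (𝓝 0))
    (hx : ∀ M, Tendsto (fun L => ∑ m ∈ range L, φ M m • y m) atTop (𝓝 (x M))) :
    Tendsto x l (𝓝 B) := by
  have hrest : Tendsto (fun m => ∑ i ∈ range (m + 1), y i - B) atTop (𝓝 0) := by
    simpa using (hy.comp (tendsto_add_atTop_nat 1)).sub_const B
  have hdiff : Tendsto (fun M => φ M 0 • B - x M) l (𝓝 0) := by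
    refine NormedAddGroup.tendsto_nhds_zero.mpr fun ε hε => ?_
    filter_upwards [hV, eventually_norm_sum_smul_le hrest hV hφ (half_pos hε)] with M hVM hM
    have hlim := tendsto_sum_succ_sub_smul hy hVM (hx M)
    exact (le_of_tendsto hlim.norm (Eventually.of_forall hM)).trans_lt (half_lt_self hε)
  simpa using (h0.smul_const B).sub hdiff

end Multipliers

section Convolution

variable {R : Type*} [Semiring R]

lemma sum_range_sum_antidiagonal_mul (f g x : ℕ → R) (L : ℕ) :
    ∑ m ∈ range L, (∑ p ∈ antidiagonal m, f p.1 * g p.2) * x m =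
      ∑ j ∈ range L, f j * ∑ i ∈ range (L - j), g i * x (i + j) := by
  simp only [mul_sum]
  rw [← sum_range_diag_flip L fun j i => f j * (g i * x (i + j))]
  refine sum_congr rfl fun m _ => ?_
  rw [Nat.sum_antidiagonal_eq_sum_range_succ_mk, sum_mul]
  refine sum_congr rfl fun j hj => ?_
  rw [Nat.sub_add_cancel (by simpa [Nat.lt_succ_iff] using hj), mul_assoc]

lemma tendsto_sum_sum_antidiagonal_mul [TopologicalSpace R] [IsTopologicalSemiring R]
    {f g x u : ℕ → R} {J : ℕ} (hf : ∀ j, J ≤ j → f j = 0)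
    (hu : ∀ j, Tendsto (fun L => ∑ i ∈ range L, g i * x (i + j)) atTop (𝓝 (u j))) :
    Tendsto (fun L => ∑ m ∈ range L, (∑ p ∈ antidiagonal m, f p.1 * g p.2) * x m) atTop
      (𝓝 (∑ j ∈ range J, f j * u j)) := by
  have hlim : Tendsto (fun L => ∑ j ∈ range J, f j * ∑ i ∈ range (L - j), g i * x (i + j)) atTop
      (𝓝 (∑ j ∈ range J, f j * u j)) :=
    tendsto_finsetSum _ fun j _ => ((hu j).comp (tendsto_sub_atTop_nat j)).const_mul (f j)
  refine hlim.congr' ?_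
  filter_upwards [eventually_ge_atTop J] with L hL
  rw [sum_range_sum_antidiagonal_mul]
  refine sum_subset (range_subset_range.mpr hL) fun j _ hj => ?_
  rw [hf j (by simpa using hj), zero_mul]

end Convolution

lemma tendsto_sum_fracDiff {a : ℝ} {Λ : ℕ → ℝ} (h : FracDiffWellDefined a Λ) (n : ℕ) :
    Tendsto (fun L => ∑ j ∈ range L, cesaroNumber (-a) j * Λ (j + n)) atTop
      (𝓝 (fracDiff a Λ n)) := by
  have hsum := (h n).hasSum
  rwa [HasSum, SummationFilter.conditional_filter_eq_map_range, tendsto_map'_iff] at hsum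

lemma tendsto_sum_polyaMean_mul {a b : ℝ} (hb : ∀ m : ℕ, b ≠ m) {Λ : ℕ → ℝ}
    (h : FracDiffWellDefined a Λ) (n : ℕ) {w : ℕ → ℝ} {J : ℕ} (hw : ∀ j, J ≤ j → w j = 0) :
    Tendsto (fun L => ∑ m ∈ range L,
        polyaMean (a - b) (-a) w m * (cesaroNumber (-b) m * Λ (m + n))) atTop
      (𝓝 (∑ j ∈ range J, w j * cesaroNumber (a - b) j * fracDiff a Λ (j + n))) := by
  have hlim := tendsto_sum_sum_antidiagonal_mul (f := fun j => w j * cesaroNumber (a - b) j)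
    (g := cesaroNumber (-a)) (x := fun m => Λ (m + n)) (u := fun j => fracDiff a Λ (j + n))
    (J := J) (fun j hj => by rw [hw j hj, zero_mul])
    (fun j => by simpa only [add_assoc] using tendsto_sum_fracDiff h (j + n))
  refine hlim.congr fun L => sum_congr rfl fun m _ => ?_
  have hne : cesaroNumber (-b) m ≠ 0 := cesaroNumber_ne_zero (fun i hi => hb i (neg_injective hi)) m
  rw [polyaMean, show a - b + -a = -b by ring, ← mul_assoc, div_mul_cancel₀ _ hne]
  simp only [mul_assoc]

theorem tendsto_sum_cesaroWeight_mul_fracDiff {a b : ℝ} (hba : b < a) (hb : ∀ m : ℕ, b ≠ m)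
    {Λ : ℕ → ℝ} (ha_def : FracDiffWellDefined a Λ) (hb_def : FracDiffWellDefined b Λ) {K : ℕ}
    (hK : 0 < K) (haK : a ≤ K) (n : ℕ) :
    Tendsto (fun M => ∑ j ∈ range (M + 1),
        cesaroWeight K M j * cesaroNumber (a - b) j * fracDiff a Λ (j + n)) atTop
      (𝓝 (fracDiff b Λ n)) := by
  have hde : ∀ i : ℕ, a - b + -a ≠ -i := fun i hi => hb i (by linarith)
  have hw : ∀ M j, M + 1 ≤ j → cesaroWeight K M j = 0 := fun M j hj =>
    cesaroWeight_eq_zero hK (by lia)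
  obtain ⟨C, -, hC⟩ := exists_abs_polyaMean_cesaroWeight_succ_sub_le K hde
  obtain ⟨V, hV⟩ :=
    exists_sum_abs_polyaMean_cesaroWeight_succ_sub_le (sub_pos.mpr hba) hde hK (by linarith)
  refine tendsto_of_tendsto_sum_smul (V := V)
    (φ := fun M => polyaMean (a - b) (-a) (cesaroWeight K M))
    (tendsto_sum_fracDiff hb_def n) ?_ ?_ (fun m => ?_)
    fun M => tendsto_sum_polyaMean_mul hb ha_def n (hw M)
  · refine tendsto_const_nhds.congr' ?_
    filter_upwards [eventually_ge_atTop K] with M hM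
    rw [polyaMean_zero_right, cesaroWeight_zero_right hM]
  · filter_upwards [eventually_ge_atTop K] with M hM using hV M hM
  · refine squeeze_zero_norm' ?_ (tendsto_const_div_atTop_nhds_zero_nat C)
    filter_upwards [eventually_ge_atTop K, eventually_gt_atTop m] with M hM hm using hC M m hM hm

theorem theorem4p4_general (Λ : ℕ → ℝ) (a b : ℝ) (hba : b < a) (hb : ∀ m : ℕ, b ≠ m)
    (ha_def : FracDiffWellDefined a Λ) (ha_nonneg : ∀ n : ℕ, 0 ≤ fracDiff a Λ n)
    (hb_def : FracDiffWellDefined b Λ) (n : ℕ) : 0 ≤ fracDiff b Λ n := by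
  obtain ⟨K, hK⟩ := exists_nat_gt (max a 0)
  have haK : a ≤ K := ((le_max_left a 0).trans_lt hK).le
  have hK0 : 0 < K := by exact_mod_cast (le_max_right a 0).trans_lt hK
  refine ge_of_tendsto' (tendsto_sum_cesaroWeight_mul_fracDiff hba hb ha_def hb_def hK0 haK n)
    fun M => sum_nonneg fun j _ => ?_
  have hpos : 0 < cesaroNumber (a - b) j := cesaroNumber_pos (sub_pos.mpr hba) j
  exact mul_nonneg (mul_nonneg (cesaroWeight_nonneg K M j) hpos.le) (ha_nonneg (j + n))

theorem theorem4p4 (Λ : ℕ → ℝ) (a b : ℝ) (hb : 0 < b) (hba : b < a)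
    (hb_int : ∀ m : ℤ, b ≠ (m : ℝ))
    (ha_def : FracDiffWellDefined a Λ) (ha_nonneg : ∀ n : ℕ, 0 ≤ fracDiff a Λ n)
    (hb_def : FracDiffWellDefined b Λ) :
    ∀ n : ℕ, 0 ≤ fracDiff b Λ n :=
  theorem4p4_general Λ a b hba (fun m => by exact_mod_cast hb_int m) ha_def ha_nonneg hb_def
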